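/- Let $m,l\ge 0$ be integers and consider the scalar delay problem $$\dot x(t)=\sum_{k=1}^m f_k\bigl(t,x(h_1(t)),\dots,x(h_l(t))\bigr)-g(t,x(t)),\quad t\ge 0,\qquad x(t)=\varphi(t),\quad t\le 0, \tag{1}$$ where (a1) $f_k:[0,\infty)\times\mathbb R^l\to[0,\infty)$ and $g:[0,\infty)\times\mathbb R\to[0,\infty)$ are Caratheodory functions (continuous in the space variables for almost all $t$; Lebesgue measurable and locally essentially bounded in $t$ for all fixed values of the space variables) and locally Lipschitz (for every interval $[a,b]$ there are constants $\alpha_j>0$ with $|f_k(t,u)-f_k(t,v)|\le\sum_j\alpha_j|u_j-v_j|$ for all $t\ge0$ and all $u_j,v_j\in[a,b]$, and similarly for $g$), with $f_k(t,0,\dots,0)=0$ and $g(t,0)=0$; (a2) $h_j:[0,\infty)\to\mathbb R$, $j=1,\dots,l$, are Lebesgue measurable, $h_j(t)\le t$ and $\lim_{t\to\infty}h_j(t)=\infty$; (a3) $\varphi:(-\infty,0]\to\mathbb R$ is nonnegative, Borel measurable and bounded, and $\varphi(0)>0$. A solution of (1) is a function $x:\mathbb R\to\mathbb R$ that is absolutely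 continuous on every interval $[0,T]$, satisfies the differential equation for almost all $t\ge0$ and equals $\varphi$ on $(-\infty,0]$. Let $a_0,A_{kj}:[0,\infty)\to[0,\infty)$ be Lebesgue measurable, locally essentially bounded functions and let $B_k\ge0$ be constants such that, for all $t\ge0$, $k=1,\dots,m$, $$g(t,u)\ge a_0(t)u\ \text{ for all }u\ge0,\qquad 0\le f_k(t,u_1,\dots,u_l)\le\sum_{j=1}^lA_{kj}(t)u_j+B_k\ \text{ for all }u_1,\dots,u_l\ge0 .$$ Suppose that the linear equation $$\dot x(t)=-a_0(t)x(t)+\sum_{k=1}^m\sum_{j=1}^lA_{kj}(t)x(h_j(t))$$ is exponentially stable, that is, there are constants $M,\gamma>0$ such that for every $t_0\ge0$ and every bounded Borel measurable $\varphi_0:(-\infty,t_0]\to\mathbb R$, each solution $x$ of this equation on $[t_0,\infty)$ with $x=\varphi_0$ on $(-\infty,t_0]$ satisfies $$|x(t)|\le M e^{-\gamma(t-t_0)}\sup_{s\le t_0}|\varphi_0(s)|,\qquad t\ge t_0 .$$ Then every solution $x$ of (1) with $x(t)>0$ for all $t\ge0$ is bounded. -/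

import Mathlib

open MeasureTheory Set Filter Topology

namespace DelayEq

/-- `a : [0, ∞) → ℝ` is Lebesgue measurable and essentially bounded on every `[0, T]`.
(Only the values on `[0, ∞)` matter.) -/
def LocallyEssBounded (a : ℝ → ℝ) : Prop :=
  AEMeasurable a (volume.restrict (Ici 0)) ∧
    ∀ T : ℝ, ∃ C : ℝ, ∀ᵐ t ∂(volume.restrict (Icc 0 T)), |a t| ≤ C

/-- Caratheodory functions `f : [0, ∞) × ℝˡ → ℝ`: continuous in `u` for almost all `t`, and
measurable and locally essentially bounded in `t` for every `u`. -/
def IsCaratheodory {l : ℕ} (f : ℝ → (Fin l → ℝ) → ℝ) : Prop :=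
  (∀ᵐ t ∂(volume.restrict (Ici (0 : ℝ))), Continuous (f t)) ∧
    ∀ u : Fin l → ℝ, LocallyEssBounded (fun t => f t u)

/-- Locally Lipschitz functions `f : [0, ∞) × ℝˡ → ℝ`: for every interval `[a, b]` there are
positive constants `α 1, …, α l`, not depending on `t`, which are Lipschitz constants
for arguments in `[a, b]`. -/
def IsLocLipschitz {l : ℕ} (f : ℝ → (Fin l → ℝ) → ℝ) : Prop :=
  ∀ a b : ℝ, a ≤ b → ∃ α : Fin l → ℝ, (∀ j, 0 < α j) ∧
    ∀ t : ℝ, 0 ≤ t → ∀ u v : Fin l → ℝ, (∀ j, u j ∈ Icc a b) → (∀ j, v j ∈ Icc a b) →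
      |f t u - f t v| ≤ ∑ j, α j * |u j - v j|

/-- A function `g : [0, ∞) × ℝ → ℝ` seen as a function of `t` and a vector with one entry. -/
def uncurryOne (g : ℝ → ℝ → ℝ) : ℝ → (Fin 1 → ℝ) → ℝ := fun t u => g t (u 0)

/-- The standing assumptions on the nonlinearities `f₁, …, f_m` and `g`. -/
structure NonlinearityAssumptions {m l : ℕ} (f : Fin m → ℝ → (Fin l → ℝ) → ℝ)
    (g : ℝ → ℝ → ℝ) : Prop where
  f_nonneg : ∀ k t, 0 ≤ t → ∀ u, 0 ≤ f k t u
  f_caratheodory : ∀ k, IsCaratheodory (f k)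
  f_lipschitz : ∀ k, IsLocLipschitz (f k)
  f_zero : ∀ k t, 0 ≤ t → f k t 0 = 0
  g_nonneg : ∀ t, 0 ≤ t → ∀ u, 0 ≤ g t u
  g_caratheodory : IsCaratheodory (uncurryOne g)
  g_lipschitz : IsLocLipschitz (uncurryOne g)
  g_zero : ∀ t, 0 ≤ t → g t 0 = 0

/-- The standing assumptions on the delayed arguments `h₁, …, h_l : [0, ∞) → ℝ`. -/
structure DelayAssumptions {l : ℕ} (h : Fin l → ℝ → ℝ) : Prop where
  measurable : ∀ j, AEMeasurable (h j) (volume.restrict (Ici 0))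
  le_self : ∀ j t, 0 ≤ t → h j t ≤ t
  tendsto_atTop : ∀ j, Tendsto (h j) atTop atTop

/-- `φ` is Borel measurable and bounded on `(-∞, t₀]`. -/
def IsInitialFunction (t₀ : ℝ) (φ : ℝ → ℝ) : Prop :=
  Measurable (fun s : Iic t₀ => φ s) ∧ ∃ K : ℝ, ∀ s ≤ t₀, |φ s| ≤ K

/-- `x : ℝ → ℝ` is absolutely continuous on every `[t₀, T]` and satisfies `x'(t) = F x t` for
almost all `t ≥ t₀`, and `x = φ` on `(-∞, t₀]`. -/
structure IsSolutionFrom (F : (ℝ → ℝ) → ℝ → ℝ) (t₀ : ℝ) (φ x : ℝ → ℝ) : Prop where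
  absCont : ∀ T, t₀ ≤ T → AbsolutelyContinuousOnInterval x t₀ T
  deriv_eq : ∀ᵐ t ∂(volume.restrict (Ici t₀)), HasDerivAt x (F x t) t
  initial : ∀ t ≤ t₀, x t = φ t

/-- The right-hand side `∑ₖ fₖ(t, x(h₁(t)), …, x(h_l(t))) - g(t, x(t))`. -/
def nonlinearRHS {m l : ℕ} (f : Fin m → ℝ → (Fin l → ℝ) → ℝ) (g : ℝ → ℝ → ℝ)
    (h : Fin l → ℝ → ℝ) (x : ℝ → ℝ) (t : ℝ) : ℝ :=
  (∑ k, f k t (fun j => x (h j t))) - g t (x t)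

/-- The right-hand side `-a₀(t) x(t) + ∑ₖ ∑ⱼ A_kj(t) x(hⱼ(t))`. -/
def linearRHS {m l : ℕ} (a₀ : ℝ → ℝ) (A : Fin m → Fin l → ℝ → ℝ)
    (h : Fin l → ℝ → ℝ) (x : ℝ → ℝ) (t : ℝ) : ℝ :=
  -a₀ t * x t + ∑ k, ∑ j, A k j t * x (h j t)

/-- Exponential stability of the linear delay equation `x'(t) = F x t`, `t ≥ 0`: there are
`M, γ > 0` such that `|x(t)| ≤ M e^{-γ (t - t₀)} sup_{s ≤ t₀} |φ(s)|` for all `t ≥ t₀`, for every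
initial point `t₀ ≥ 0`, every bounded Borel initial function `φ` on `(-∞, t₀]` and the
solution `x` with this initial function. The constants do not depend on `t₀` and `φ`. -/
def IsExponentiallyStable (F : (ℝ → ℝ) → ℝ → ℝ) : Prop :=
  ∃ M γ : ℝ, 0 < M ∧ 0 < γ ∧
    ∀ t₀ : ℝ, 0 ≤ t₀ → ∀ φ x : ℝ → ℝ, IsInitialFunction t₀ φ → IsSolutionFrom F t₀ φ x →
      ∀ t, t₀ ≤ t → |x t| ≤ M * Real.exp (-γ * (t - t₀)) * ⨆ s : Iic t₀, |φ s|

end DelayEq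

/-!
A positive solution `x` of the nonlinear equation satisfies `x' ≤ L x + B` almost everywhere,
where `L` is the linear delay operator and `B = ∑ₖ Bₖ`, so it is enough to bound subsolutions of the
stable linear equation with a constant source (`DelayEq.le_of_subsolution_source`).

A comparison principle (`DelayEq.nonpos_of_subsolution`) reduces this to finding a bounded
supersolution with initial function `φ`. The homogeneous solution `u` with initial function `φ`
is bounded by exponential stability and takes care of the history. For the source, the classical
variation of constants formula `∫ X(t, s) B ds` is replaced by a discrete sum, which needs neither
regularity of the fundamental solution `X(t, s)` in `s` nor a representation theorem: on
`[0, T]` take a partition `0 = s₀ < ⋯ < s_N = T` so fine that `X(·, sᵢ) ≥ 1 / 2` on `[sᵢ, sᵢ₊₁]`, and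
consider `∑ᵢ cᵢ(t) X(t, sᵢ)`, where `cᵢ` grows from zero with slope `2 B` on `[sᵢ, sᵢ₊₁]` and is
constant elsewhere. As `cᵢ` is nondecreasing, `X ≥ 0` and the delayed arguments do not exceed `t`,
each summand is a supersolution for the source `B` on `(sᵢ, sᵢ₊₁)`
(`DelayEq.exists_hasDerivAt_ramp_mul`). Stability gives `X(T, s) ≤ M exp (-γ (T - s))`, and the sum at
time `T` is a lower Riemann sum of an exponential, hence at most `2 B M / γ` for every `T`.

Stability only speaks about existing solutions, so `u` and `X(·, sᵢ)` have to be constructed: this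
is done with a Picard series (`DelayEq.exists_isSolutionFrom_linearRHS`).
-/

namespace DelayEq

/-! ### Absolutely continuous functions -/

theorem absolutelyContinuousOnInterval_congr {f g : ℝ → ℝ} {a b : ℝ}
    (hf : AbsolutelyContinuousOnInterval f a b) (hfg : EqOn f g (uIcc a b)) :
    AbsolutelyContinuousOnInterval g a b := by
  rw [absolutelyContinuousOnInterval_iff] at hf ⊢
  intro ε hε
  obtain ⟨δ, hδ, H⟩ := hf ε hε
  refine ⟨δ, hδ, fun E hE hEδ => ?_⟩
  convert H E hE hEδ using 1
  refine Finset.sum_congr rfl fun i hi => ?_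
  rw [hfg (hE.1 i hi).1, hfg (hE.1 i hi).2]

/-- The projection `t ↦ max t c` does not increase distances and maps disjoint intervals to
disjoint intervals, so composing with it preserves absolute continuity. -/
theorem absolutelyContinuousOnInterval_comp_max {f : ℝ → ℝ} {a b c : ℝ}
    (hf : AbsolutelyContinuousOnInterval f c b) (hab : a ≤ b) (hcb : c ≤ b) :
    AbsolutelyContinuousOnInterval (fun t => f (max t c)) a b := by
  rw [absolutelyContinuousOnInterval_iff] at hf ⊢
  intro ε hε
  obtain ⟨δ, hδ, H⟩ := hf ε hε
  refine ⟨δ, hδ, fun E hE hEδ => ?_⟩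
  refine H (E.1, fun i => (max (E.2 i).1 c, max (E.2 i).2 c)) ⟨fun i hi => ?_, ?_⟩ ?_
  · have := hE.1 i hi
    rw [uIcc_of_le hab] at this
    rw [uIcc_of_le hcb]
    exact ⟨⟨le_max_right _ _, max_le this.1.2 hcb⟩, ⟨le_max_right _ _, max_le this.2.2 hcb⟩⟩
  · have key : ∀ p q : ℝ, uIoc (max p c) (max q c) ⊆ uIoc p q := by
      intro p q r hr
      simp only [uIoc, mem_Ioc] at hr ⊢
      grind
    intro i hi j hj hij
    exact (hE.2 hi hj hij).mono (key _ _) (key _ _)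
  · refine lt_of_le_of_lt (Finset.sum_le_sum fun i _ => ?_) hEδ
    simp only [Real.dist_eq]
    exact abs_max_sub_max_le_abs _ _ _

theorem absolutelyContinuousOnInterval_finset_sum {ι : Type*} (s : Finset ι) {f : ι → ℝ → ℝ}
    {a b : ℝ} (hf : ∀ i ∈ s, AbsolutelyContinuousOnInterval (f i) a b) :
    AbsolutelyContinuousOnInterval (fun t => ∑ i ∈ s, f i t) a b := by
  classical
  induction s using Finset.induction_on with
  | empty =>
    simpa using (contDiffOn_const (c := (0 : ℝ))).absolutelyContinuousOnInterval (a := a) (b := b)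
  | insert i s hi ih =>
    simp only [Finset.sum_insert hi]
    exact (hf i (by simp)).fun_add (ih fun j hj => hf j (by simp [hj]))

/-- An absolutely continuous function grows at most as fast as a `C¹` function whose derivative
dominates its own almost everywhere. -/
theorem sub_le_sub_of_ae_hasDerivAt_le {f ψ ψ' : ℝ → ℝ} {a b : ℝ} (hab : a ≤ b)
    (hf : AbsolutelyContinuousOnInterval f a b) (hψ : ContDiff ℝ 1 ψ)
    (hψ' : ∀ t, HasDerivAt ψ (ψ' t) t)
    (hle : ∀ᵐ t, t ∈ Ioo a b → ∃ d, HasDerivAt f d t ∧ d ≤ ψ' t) :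
    f b - f a ≤ ψ b - ψ a := by
  have hac := hf.fun_sub (hψ.contDiffOn.absolutelyContinuousOnInterval (a := a) (b := b))
  have h1 := hac.integral_deriv_eq_sub
  have h2 : ∫ t in a..b, deriv (fun t => f t - ψ t) t ≤ 0 := by
    rw [intervalIntegral.integral_of_le hab, integral_Ioc_eq_integral_Ioo]
    refine integral_nonpos_of_ae ?_
    rw [EventuallyLE, ae_restrict_iff' measurableSet_Ioo]
    filter_upwards [hle] with t ht hmem
    obtain ⟨d, hd, hdle⟩ := ht hmem
    have hd' : HasDerivAt (fun t => f t - ψ t) (d - ψ' t) t := hd.sub (hψ' t)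
    rw [hd'.deriv]
    simpa using hdle
  linarith

/-! ### The linear delay operator -/

section Linear

variable {m l : ℕ} {a₀ : ℝ → ℝ} {A : Fin m → Fin l → ℝ → ℝ} {h : Fin l → ℝ → ℝ}

theorem linearRHS_sub (y z : ℝ → ℝ) (t : ℝ) :
    linearRHS a₀ A h (fun s => y s - z s) t = linearRHS a₀ A h y t - linearRHS a₀ A h z t := by
  simp only [linearRHS, mul_sub, Finset.sum_sub_distrib]
  ring

theorem linearRHS_neg (y : ℝ → ℝ) (t : ℝ) :
    linearRHS a₀ A h (fun s => -y s) t = -linearRHS a₀ A h y t := by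
  simp only [linearRHS, mul_neg, Finset.sum_neg_distrib]
  ring

theorem linearRHS_finset_sum {ι : Type*} (s : Finset ι) (y : ι → ℝ → ℝ) (t : ℝ) :
    linearRHS a₀ A h (fun r => ∑ i ∈ s, y i r) t = ∑ i ∈ s, linearRHS a₀ A h (y i) t := by
  simp only [linearRHS, Finset.mul_sum, Finset.sum_add_distrib]
  congr 1
  rw [Finset.sum_comm (s := s)]
  exact Finset.sum_congr rfl fun k _ => Finset.sum_comm

theorem abs_linearRHS_le (hh : DelayAssumptions h) {y : ℝ → ℝ} {t K : ℝ} (ht : 0 ≤ t)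
    (hy : ∀ s ≤ t, |y s| ≤ K) :
    |linearRHS a₀ A h y t| ≤ (|a₀ t| + ∑ k, ∑ j, |A k j t|) * K := by
  unfold linearRHS
  rw [add_mul, Finset.sum_mul]
  refine (abs_add_le _ _).trans (add_le_add ?_ ?_)
  · rw [abs_mul, abs_neg]
    exact mul_le_mul_of_nonneg_left (hy t le_rfl) (abs_nonneg _)
  · refine (Finset.abs_sum_le_sum_abs _ _).trans (Finset.sum_le_sum fun k _ => ?_)
    rw [Finset.sum_mul]
    refine (Finset.abs_sum_le_sum_abs _ _).trans (Finset.sum_le_sum fun j _ => ?_)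
    rw [abs_mul]
    exact mul_le_mul_of_nonneg_left (hy _ (hh.le_self j t ht)) (abs_nonneg _)

theorem aemeasurable_linearRHS (hh : DelayAssumptions h) (ha₀ : LocallyEssBounded a₀)
    (hA : ∀ k j, LocallyEssBounded (A k j)) {y : ℝ → ℝ} (hy : Measurable y) :
    AEMeasurable (linearRHS a₀ A h y) (volume.restrict (Ici 0)) := by
  unfold linearRHS
  refine (ha₀.1.neg.mul hy.aemeasurable).add ?_
  refine Finset.aemeasurable_fun_sum _ fun k _ => Finset.aemeasurable_fun_sum _ fun j _ => ?_
  exact (hA k j).1.mul (hy.comp_aemeasurable (hh.measurable j))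

/-- On bounded time intervals the coefficients have a common essential bound. -/
theorem exists_coeff_bound (ha₀ : LocallyEssBounded a₀) (hA : ∀ k j, LocallyEssBounded (A k j))
    (T : ℝ) :
    ∃ C : ℝ, 0 < C ∧ ∀ᵐ t, t ∈ Icc 0 T → |a₀ t| + ∑ k, ∑ j, |A k j t| ≤ C := by
  obtain ⟨C₀, hC₀⟩ := ha₀.2 T
  choose D hD using fun k j => (hA k j).2 T
  refine ⟨max 1 (C₀ + ∑ k, ∑ j, D k j), by positivity, ?_⟩
  rw [← ae_restrict_iff' measurableSet_Icc]
  have hD' : ∀ᵐ t ∂(volume.restrict (Icc 0 T)), ∀ k j, |A k j t| ≤ D k j :=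
    ae_all_iff.2 fun k => ae_all_iff.2 fun j => hD k j
  filter_upwards [hC₀, hD'] with t h1 h2
  exact le_max_of_le_right (add_le_add h1
    (Finset.sum_le_sum fun k _ => Finset.sum_le_sum fun j _ => h2 k j))

/-- Comparison principle: a subsolution of the linear delay equation with nonpositive history
stays nonpositive. -/
theorem nonpos_of_subsolution (hh : DelayAssumptions h) (ha₀ : LocallyEssBounded a₀)
    (hA : ∀ k j, LocallyEssBounded (A k j)) (ha₀_nonneg : ∀ t, 0 ≤ t → 0 ≤ a₀ t)
    (hA_nonneg : ∀ k j t, 0 ≤ t → 0 ≤ A k j t) {v : ℝ → ℝ} {t₀ T : ℝ} (ht₀ : 0 ≤ t₀)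
    (hv : AbsolutelyContinuousOnInterval v t₀ T) (hinit : ∀ t ≤ t₀, v t ≤ 0)
    (hderiv : ∀ᵐ t, t ∈ Ioo t₀ T → ∃ d, HasDerivAt v d t ∧ d ≤ linearRHS a₀ A h v t) :
    ∀ t ≤ T, v t ≤ 0 := by
  rcases le_or_gt T t₀ with hT | hT
  · exact fun t ht => hinit t (ht.trans hT)
  obtain ⟨C, hC, hbound⟩ := exists_coeff_bound ha₀ hA T
  have hcont : ContinuousOn v (Icc t₀ T) := by simpa [uIcc_of_le hT.le] using hv.continuousOn
  obtain ⟨τ, hτ, hmax⟩ := isCompact_Icc.exists_isMaxOn (nonempty_Icc.2 hT.le)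
    (hcont.mul (f := v) (g := fun t => Real.exp (-(C * t))) (by fun_prop))
  set μ := v τ * Real.exp (-(C * τ)) with hμ
  have hμτ : v τ = μ * Real.exp (C * τ) := by
    rw [hμ, mul_assoc, ← Real.exp_add]; simp
  have hle : ∀ t ∈ Icc t₀ T, v t ≤ μ * Real.exp (C * t) := by
    intro t ht
    have h1 : v t * Real.exp (-(C * t)) ≤ μ := hmax ht
    calc v t = v t * Real.exp (-(C * t)) * Real.exp (C * t) := by
          rw [mul_assoc, ← Real.exp_add]; simp
      _ ≤ _ := mul_le_mul_of_nonneg_right h1 (Real.exp_pos _).le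
  -- It suffices that the maximum `μ` of `v t * exp (-C t)` is nonpositive.
  suffices hμ0 : μ ≤ 0 by
    intro t ht
    rcases le_or_gt t t₀ with h1 | h1
    · exact hinit t h1
    · exact (hle t ⟨h1.le, ht⟩).trans (mul_nonpos_of_nonpos_of_nonneg hμ0 (Real.exp_pos _).le)
  by_contra! hμ0
  have hle' : ∀ t ≤ T, v t ≤ μ * Real.exp (C * t) := by
    intro t ht
    rcases le_or_gt t t₀ with h1 | h1
    · exact (hinit t h1).trans (by positivity)
    · exact hle t ⟨h1.le, ht⟩
  -- `σ` is the last point up to the maximum point `τ` with `v σ ≤ 0`, so `v > 0` on `(σ, τ)`.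
  have hclosed : IsCompact (Icc t₀ τ ∩ v ⁻¹' Iic 0) :=
    isCompact_Icc.of_isClosed_subset
      ((hcont.mono (Icc_subset_Icc_right hτ.2)).preimage_isClosed_of_isClosed isClosed_Icc
        isClosed_Iic) inter_subset_left
  obtain ⟨σ, hσ, hσmax⟩ := hclosed.exists_isGreatest
    ⟨t₀, ⟨le_rfl, hτ.1⟩, hinit t₀ le_rfl⟩
  have hpos : ∀ t ∈ Ioo σ τ, 0 < v t := by
    intro t ht
    by_contra! hneg
    exact absurd (hσmax ⟨⟨hσ.1.1.trans ht.1.le, ht.2.le⟩, hneg⟩) (not_le.2 ht.1)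
  have key := sub_le_sub_of_ae_hasDerivAt_le (ψ := fun t => μ * Real.exp (C * t))
    (ψ' := fun t => C * (μ * Real.exp (C * t))) hσ.1.2
    (hv.mono (by
      rw [uIcc_of_le hσ.1.2, uIcc_of_le hT.le]
      exact Icc_subset_Icc hσ.1.1 hτ.2)) (by fun_prop)
    (fun t => by
      have := (((hasDerivAt_id t).const_mul C).exp).const_mul μ
      convert! this using 1
      simp; ring) (by
      filter_upwards [hderiv, hbound] with t h1 h2 ht
      have htT : t < T := ht.2.trans_le hτ.2
      have ht0 : 0 ≤ t := ht₀.trans (hσ.1.1.trans ht.1.le)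
      obtain ⟨d, hd, hdle⟩ := h1 ⟨hσ.1.1.trans_lt ht.1, htT⟩
      refine ⟨d, hd, hdle.trans ?_⟩
      have hE : 0 < μ * Real.exp (C * t) := by positivity
      have h3 : ∑ k, ∑ j, A k j t * v (h j t) ≤ (∑ k, ∑ j, |A k j t|) * (μ * Real.exp (C * t)) := by
        rw [Finset.sum_mul]
        refine Finset.sum_le_sum fun k _ => ?_
        rw [Finset.sum_mul]
        refine Finset.sum_le_sum fun j _ => ?_
        rw [abs_of_nonneg (hA_nonneg k j t ht0)]
        refine mul_le_mul_of_nonneg_left ?_ (hA_nonneg k j t ht0)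
        have hht := hh.le_self j t ht0
        refine (hle' _ (hht.trans htT.le)).trans ?_
        gcongr
      have h4 : 0 ≤ a₀ t * v t := mul_nonneg (ha₀_nonneg t ht0) (hpos t ht).le
      have h5 : (∑ k, ∑ j, |A k j t|) * (μ * Real.exp (C * t)) ≤ C * (μ * Real.exp (C * t)) := by
        refine mul_le_mul_of_nonneg_right ?_ hE.le
        linarith [h2 ⟨ht0, htT.le⟩, abs_nonneg (a₀ t)]
      unfold linearRHS
      linarith)
  have hσ0 : v σ ≤ 0 := hσ.2
  have : 0 < μ * Real.exp (C * σ) := by positivity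
  simp only [← hμτ] at key
  linarith

end Linear

/-! ### Existence of solutions of the linear delay equation -/

section Existence

variable {m l : ℕ} {a₀ : ℝ → ℝ} {A : Fin m → Fin l → ℝ → ℝ} {h : Fin l → ℝ → ℝ}

/-- The right-hand side of the linear delay equation, set to zero up to the initial time `t₀`. -/
noncomputable def forcing (a₀ : ℝ → ℝ) (A : Fin m → Fin l → ℝ → ℝ) (h : Fin l → ℝ → ℝ) (t₀ : ℝ)
    (y : ℝ → ℝ) : ℝ → ℝ :=
  (Ioi t₀).indicator (linearRHS a₀ A h y)

/-- The terms of the Picard series: the initial function frozen after `t₀`, followed by the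
iterated integrals of the right-hand side. The sum of the series is the solution. -/
noncomputable def picardTerm (a₀ : ℝ → ℝ) (A : Fin m → Fin l → ℝ → ℝ) (h : Fin l → ℝ → ℝ) (t₀ : ℝ)
    (φ : ℝ → ℝ) : ℕ → ℝ → ℝ
  | 0 => fun t => φ (min t t₀)
  | n + 1 => fun t => ∫ s in t₀..t, forcing a₀ A h t₀ (picardTerm a₀ A h t₀ φ n) s

theorem integrableOn_forcing (hh : DelayAssumptions h) (ha₀ : LocallyEssBounded a₀)
    (hA : ∀ k j, LocallyEssBounded (A k j)) {t₀ : ℝ} (ht₀ : 0 ≤ t₀) {y : ℝ → ℝ}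
    (hy : Measurable y) (hyb : ∀ T, ∃ K, ∀ s ≤ T, |y s| ≤ K) (T : ℝ) :
    IntegrableOn (forcing a₀ A h t₀ y) (Iic T) := by
  obtain ⟨C, hC, hbound⟩ := exists_coeff_bound ha₀ hA T
  obtain ⟨K, hK⟩ := hyb T
  unfold forcing
  rw [IntegrableOn, integrable_indicator_iff measurableSet_Ioi, IntegrableOn,
    Measure.restrict_restrict measurableSet_Ioi, Ioi_inter_Iic, ← IntegrableOn]
  refine IntegrableOn.of_bound (by simp) ?_ (C * K) ?_
  · exact ((aemeasurable_linearRHS hh ha₀ hA hy).mono_measure (Measure.restrict_mono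
      (fun t ht => ht₀.trans ht.1.le) le_rfl)).aestronglyMeasurable
  · rw [ae_restrict_iff' measurableSet_Ioc]
    filter_upwards [hbound] with t ht hmem
    have h0 : 0 ≤ t := ht₀.trans hmem.1.le
    have hK0 : 0 ≤ K := (abs_nonneg _).trans (hK t hmem.2)
    exact (abs_linearRHS_le hh h0 fun s hs => hK s (hs.trans hmem.2)).trans
      (mul_le_mul_of_nonneg_right (ht ⟨h0, hmem.2⟩) hK0)

theorem intervalIntegrable_forcing (hh : DelayAssumptions h) (ha₀ : LocallyEssBounded a₀)
    (hA : ∀ k j, LocallyEssBounded (A k j)) {t₀ : ℝ} (ht₀ : 0 ≤ t₀) {y : ℝ → ℝ}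
    (hy : Measurable y) (hyb : ∀ T, ∃ K, ∀ s ≤ T, |y s| ≤ K) (a b : ℝ) :
    IntervalIntegrable (forcing a₀ A h t₀ y) volume a b := by
  rw [intervalIntegrable_iff]
  exact (integrableOn_forcing hh ha₀ hA ht₀ hy hyb (max a b)).mono_set fun t ht => ht.2

theorem integral_forcing_eq_zero {t₀ t : ℝ} (y : ℝ → ℝ) (ht : t ≤ t₀) :
    ∫ s in t₀..t, forcing a₀ A h t₀ y s = 0 := by
  refine intervalIntegral.integral_zero_ae (Eventually.of_forall fun s hs => ?_)
  rw [uIoc_of_ge ht] at hs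
  exact indicator_of_notMem (not_lt.2 hs.2) _

/-- In the weighted supremum norm with weight `exp (2 C (t - t₀)⁺)`, where `C` bounds the
coefficients, integrating the right-hand side is a contraction with constant `1 / 2`. -/
theorem abs_integral_forcing_le (hh : DelayAssumptions h) {t₀ T C K : ℝ} (ht₀ : 0 ≤ t₀)
    (hC : 0 < C) (hbound : ∀ᵐ t, t ∈ Icc 0 T → |a₀ t| + ∑ k, ∑ j, |A k j t| ≤ C)
    {y : ℝ → ℝ} (hK : 0 ≤ K) (hy : ∀ s ≤ T, |y s| ≤ K * Real.exp (2 * C * max (s - t₀) 0)) :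
    ∀ t ≤ T, |∫ s in t₀..t, forcing a₀ A h t₀ y s| ≤
      K * (1 / 2) * Real.exp (2 * C * max (t - t₀) 0) := by
  intro t htT
  rcases le_or_gt t t₀ with ht | ht
  · rw [integral_forcing_eq_zero y ht, abs_zero]
    positivity
  have h1 : ‖∫ s in t₀..t, forcing a₀ A h t₀ y s‖ ≤
      ∫ s in t₀..t, C * (K * Real.exp (2 * C * (s - t₀))) := by
    refine intervalIntegral.norm_integral_le_of_norm_le ht.le ?_
      (Continuous.intervalIntegrable (by fun_prop) _ _)
    filter_upwards [hbound] with s hs hmem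
    have hs0 : 0 ≤ s := ht₀.trans hmem.1.le
    have hsT : s ≤ T := hmem.2.trans htT
    rw [forcing, indicator_of_mem (show s ∈ Ioi t₀ from hmem.1), Real.norm_eq_abs]
    refine (abs_linearRHS_le hh hs0 (K := K * Real.exp (2 * C * (s - t₀))) fun r hr => ?_).trans
      (mul_le_mul_of_nonneg_right (hs ⟨hs0, hsT⟩) (by positivity))
    refine (hy r (hr.trans hsT)).trans ?_
    have : max (r - t₀) 0 ≤ s - t₀ := max_le (by linarith) (by linarith [hmem.1])
    gcongr
  have h2 : ∫ s in t₀..t, C * (K * Real.exp (2 * C * (s - t₀))) =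
      K * (1 / 2) * Real.exp (2 * C * (t - t₀)) - K * (1 / 2) * Real.exp (2 * C * (t₀ - t₀)) := by
    refine intervalIntegral.integral_eq_sub_of_hasDerivAt
      (f := fun s => K * (1 / 2) * Real.exp (2 * C * (s - t₀))) (fun s _ => ?_)
      (Continuous.intervalIntegrable (by fun_prop) _ _)
    have := ((((hasDerivAt_id s).sub_const t₀).const_mul (2 * C)).exp).const_mul (K * (1 / 2))
    convert! this using 1
    simp; ring
  rw [h2, Real.norm_eq_abs] at h1
  rw [max_eq_left (by linarith)]
  have : 0 ≤ K * (1 / 2) * Real.exp (2 * C * (t₀ - t₀)) := by positivity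
  linarith

theorem measurable_picardTerm (hh : DelayAssumptions h) (ha₀ : LocallyEssBounded a₀)
    (hA : ∀ k j, LocallyEssBounded (A k j)) {t₀ : ℝ} (ht₀ : 0 ≤ t₀) {φ : ℝ → ℝ}
    (hφ : IsInitialFunction t₀ φ)
    (hb : ∀ n T, ∃ K, ∀ s ≤ T, |picardTerm a₀ A h t₀ φ n s| ≤ K) (n : ℕ) :
    Measurable (picardTerm a₀ A h t₀ φ n) := by
  induction n with
  | zero =>
    exact hφ.1.comp (g := fun s : Iic t₀ => φ s)
      (f := fun t : ℝ => (⟨min t t₀, mem_Iic.2 (min_le_right t t₀)⟩ : Iic t₀))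
      (Measurable.subtype_mk (by fun_prop))
  | succ n ih =>
    exact (intervalIntegral.continuous_primitive
      (intervalIntegrable_forcing hh ha₀ hA ht₀ ih (hb n)) t₀).measurable

theorem abs_picardTerm_le (hh : DelayAssumptions h) {t₀ T C K : ℝ} (ht₀ : 0 ≤ t₀)
    (hC : 0 < C) (hbound : ∀ᵐ t, t ∈ Icc 0 T → |a₀ t| + ∑ k, ∑ j, |A k j t| ≤ C)
    {φ : ℝ → ℝ} (hφ : ∀ s ≤ t₀, |φ s| ≤ K) (n : ℕ) :
    ∀ t ≤ T, |picardTerm a₀ A h t₀ φ n t| ≤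
      K * (1 / 2) ^ n * Real.exp (2 * C * max (t - t₀) 0) := by
  have hK : 0 ≤ K := (abs_nonneg _).trans (hφ t₀ le_rfl)
  induction n with
  | zero =>
    intro t _
    have h1 : |φ (min t t₀)| ≤ K := hφ _ (min_le_right _ _)
    have h2 : 1 ≤ Real.exp (2 * C * max (t - t₀) 0) := Real.one_le_exp (by positivity)
    simpa [picardTerm] using h1.trans (le_mul_of_one_le_right hK h2)
  | succ n ih =>
    intro t ht
    have := abs_integral_forcing_le hh ht₀ hC hbound (by positivity) ih t ht
    rwa [pow_succ, ← mul_assoc]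

/-- The linear delay equation has a global solution for every initial time `t₀ ≥ 0` and every
bounded Borel initial function. -/
theorem exists_isSolutionFrom_linearRHS (hh : DelayAssumptions h) (ha₀ : LocallyEssBounded a₀)
    (hA : ∀ k j, LocallyEssBounded (A k j)) {t₀ : ℝ} (ht₀ : 0 ≤ t₀) {φ : ℝ → ℝ}
    (hφ : IsInitialFunction t₀ φ) :
    ∃ y, IsSolutionFrom (linearRHS a₀ A h) t₀ φ y := by
  obtain ⟨K, hK⟩ := hφ.2
  have hK0 : 0 ≤ K := (abs_nonneg _).trans (hK t₀ le_rfl)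
  set d := picardTerm a₀ A h t₀ φ with hd
  -- On `(-∞, T]` the Picard series is dominated by a geometric series with constant terms.
  have hbd : ∀ T, ∃ K', ∀ n, ∀ s ≤ T, |d n s| ≤ K' * (1 / 2) ^ n := by
    intro T
    obtain ⟨C, hC, hbound⟩ := exists_coeff_bound ha₀ hA T
    refine ⟨K * Real.exp (2 * C * max (T - t₀) 0), fun n s hs => ?_⟩
    refine (abs_picardTerm_le hh ht₀ hC hbound hK n s hs).trans ?_
    rw [mul_right_comm]
    have : max (s - t₀) 0 ≤ max (T - t₀) 0 := max_le_max (by linarith) le_rfl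
    gcongr
  have hgeom : ∀ K' : ℝ, Summable fun n : ℕ => K' * (1 / 2 : ℝ) ^ n := fun K' =>
    summable_geometric_two.mul_left K'
  have hdb : ∀ n T, ∃ K', ∀ s ≤ T, |d n s| ≤ K' := fun n T =>
    (hbd T).elim fun K' hK' => ⟨_, hK' n⟩
  have hmeas : ∀ n, Measurable (d n) := measurable_picardTerm hh ha₀ hA ht₀ hφ hdb
  have hsumm : ∀ t, Summable fun n => d n t := by
    intro t
    obtain ⟨K', hK'⟩ := hbd t
    exact Summable.of_norm_bounded (hgeom K') fun n => hK' n t le_rfl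
  set y : ℝ → ℝ := fun t => ∑' n, d n t with hy
  have hys : ∀ t, HasSum (fun n => d n t) (y t) := fun t => (hsumm t).hasSum
  have hymeas : Measurable y :=
    measurable_of_tendsto_metrizable
      (f := fun N t => ∑ n ∈ Finset.range N, d n t)
      (fun N => Finset.measurable_fun_sum _ fun n _ => hmeas n)
      (tendsto_pi_nhds.2 fun t => (hys t).tendsto_sum_nat)
  have hyb : ∀ T, ∃ K', ∀ s ≤ T, |y s| ≤ K' := by
    intro T
    obtain ⟨K', hK'⟩ := hbd T
    exact ⟨∑' n : ℕ, K' * (1 / 2 : ℝ) ^ n, fun s hs =>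
      tsum_of_norm_bounded (f := fun n => d n s) (hgeom K').hasSum fun n => hK' n s hs⟩
  have hFs : ∀ t, HasSum (fun n => forcing a₀ A h t₀ (d n) t) (forcing a₀ A h t₀ y t) := by
    intro t
    by_cases ht : t ∈ Ioi t₀
    · simp only [forcing, indicator_of_mem ht, linearRHS]
      exact ((hys t).mul_left _).add (hasSum_sum fun k _ => hasSum_sum fun j _ =>
        (hys (h j t)).mul_left _)
    · simpa only [forcing, indicator_of_notMem ht] using hasSum_zero
  have hint := intervalIntegrable_forcing hh ha₀ hA ht₀ hymeas hyb
  -- Summing the Picard terms gives the integral equation.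
  have hIE : ∀ t, y t = φ (min t t₀) + ∫ s in t₀..t, forcing a₀ A h t₀ y s := by
    intro t
    have h1 : HasSum (fun n => ∫ s in t₀..t, forcing a₀ A h t₀ (d n) s)
        (∫ s in t₀..t, forcing a₀ A h t₀ y s) := by
      obtain ⟨C, hC, hbound⟩ := exists_coeff_bound ha₀ hA (max t₀ t)
      obtain ⟨K', hK'⟩ := hbd (max t₀ t)
      refine intervalIntegral.hasSum_integral_of_dominated_convergence
        (fun n _ => C * K' * (1 / 2) ^ n)
        (fun n => (intervalIntegrable_iff.1 (intervalIntegrable_forcing hh ha₀ hA ht₀ (hmeas n)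
          (hdb n) t₀ t)).aestronglyMeasurable) (fun n => ?_)
        (Eventually.of_forall fun s _ => hgeom _) intervalIntegrable_const
        (Eventually.of_forall fun s _ => hFs s)
      filter_upwards [hbound] with s hs hmem
      have hle : s ≤ max t₀ t := hmem.2
      have hnn : 0 ≤ K' * (1 / 2) ^ n := (abs_nonneg _).trans (hK' n s hle)
      by_cases hst : s ∈ Ioi t₀
      · have hs0 : 0 ≤ s := ht₀.trans (le_of_lt hst)
        rw [forcing, indicator_of_mem hst, mul_assoc]
        exact (abs_linearRHS_le hh hs0 fun r hr => hK' n r (hr.trans hle)).trans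
          (mul_le_mul_of_nonneg_right (hs ⟨hs0, hle⟩) hnn)
      · rw [forcing, indicator_of_notMem hst, norm_zero, mul_assoc]
        positivity
    have h2 : HasSum (fun n => d n t) (d 0 t + ∫ s in t₀..t, forcing a₀ A h t₀ y s) :=
      (hasSum_nat_add_iff' 1).1 (by simpa [hd, picardTerm] using h1)
    exact (hys t).unique h2
  refine ⟨y, fun T hT => ?_, ?_, fun t ht => ?_⟩
  · refine absolutelyContinuousOnInterval_congr
      (((contDiffOn_const (c := φ t₀)).absolutelyContinuousOnInterval).fun_add
        ((hint t₀ T).absolutelyContinuousOnInterval_intervalIntegral (c := t₀) (by simp))) ?_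
    intro t ht
    rw [uIcc_of_le hT] at ht
    rw [hIE t, min_eq_right ht.1]
  · have hloc : LocallyIntegrable (forcing a₀ A h t₀ y) volume := by
      rw [locallyIntegrable_iff]
      intro k hk
      obtain ⟨b, hb⟩ := hk.bddAbove
      exact (integrableOn_forcing hh ha₀ hA ht₀ hymeas hyb b).mono_set hb
    rw [← restrict_Ioi_eq_restrict_Ici, ae_restrict_iff' measurableSet_Ioi]
    filter_upwards [_root_.LocallyIntegrable.ae_hasDerivAt_integral hloc] with t ht hmem
    have h1 := (ht t₀).const_add (φ t₀)
    rw [forcing, indicator_of_mem hmem] at h1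
    refine h1.congr_of_eventuallyEq ?_
    filter_upwards [Ioi_mem_nhds hmem] with s hs
    rw [hIE s, min_eq_right (le_of_lt hs)]
    rfl
  · rw [hIE t, integral_forcing_eq_zero y ht, min_eq_left ht, add_zero]

end Existence

/-! ### Bounded supersolutions for a constant source -/

section Source

variable {m l : ℕ} {a₀ : ℝ → ℝ} {A : Fin m → Fin l → ℝ → ℝ} {h : Fin l → ℝ → ℝ}

theorem IsSolutionFrom.nonneg (hh : DelayAssumptions h) (ha₀ : LocallyEssBounded a₀)
    (hA : ∀ k j, LocallyEssBounded (A k j)) (ha₀_nonneg : ∀ t, 0 ≤ t → 0 ≤ a₀ t)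
    (hA_nonneg : ∀ k j t, 0 ≤ t → 0 ≤ A k j t) {t₀ : ℝ} (ht₀ : 0 ≤ t₀) {φ y : ℝ → ℝ}
    (hy : IsSolutionFrom (linearRHS a₀ A h) t₀ φ y) (hφ : ∀ s ≤ t₀, 0 ≤ φ s) (t : ℝ) :
    0 ≤ y t := by
  rcases le_or_gt t t₀ with ht | ht
  · rw [hy.initial t ht]
    exact hφ t ht
  have hd := (ae_restrict_iff' measurableSet_Ici).1 hy.deriv_eq
  refine neg_nonpos.1 (nonpos_of_subsolution (v := fun s => -y s) hh ha₀ hA ha₀_nonneg hA_nonneg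
    ht₀ (hy.absCont t ht.le).fun_neg (fun s hs => ?_) ?_ t le_rfl)
  · rw [hy.initial s hs]
    exact neg_nonpos.2 (hφ s hs)
  · filter_upwards [hd] with s hs hmem
    exact ⟨_, (hs hmem.1.le).neg, (linearRHS_neg y s).ge⟩

/-- The fundamental solution of an exponentially stable linear equation: it starts at time `s`
with the value `1` after a zero history, is nonnegative, and decays exponentially. -/
theorem exists_fundamentalSolution (hh : DelayAssumptions h) (ha₀ : LocallyEssBounded a₀)
    (hA : ∀ k j, LocallyEssBounded (A k j)) (ha₀_nonneg : ∀ t, 0 ≤ t → 0 ≤ a₀ t)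
    (hA_nonneg : ∀ k j t, 0 ≤ t → 0 ≤ A k j t) {M γ : ℝ} (hM : 0 < M)
    (hstable : ∀ t₀ : ℝ, 0 ≤ t₀ → ∀ φ x : ℝ → ℝ, IsInitialFunction t₀ φ →
      IsSolutionFrom (linearRHS a₀ A h) t₀ φ x →
        ∀ t, t₀ ≤ t → |x t| ≤ M * Real.exp (-γ * (t - t₀)) * ⨆ s : Iic t₀, |φ s|)
    {s : ℝ} (hs : 0 ≤ s) :
    ∃ X : ℝ → ℝ, IsSolutionFrom (linearRHS a₀ A h) s (indicator {s} 1) X ∧ (∀ t, 0 ≤ X t) ∧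
      ∀ t, s ≤ t → X t ≤ M * Real.exp (-γ * (t - s)) := by
  have hle : ∀ r, |indicator {s} (1 : ℝ → ℝ) r| ≤ 1 := by
    intro r
    by_cases hr : r ∈ ({s} : Set ℝ) <;> simp [hr]
  have hinit : IsInitialFunction s (indicator {s} 1) :=
    ⟨(measurable_one.indicator (measurableSet_singleton s)).comp measurable_subtype_coe,
      1, fun r _ => hle r⟩
  obtain ⟨X, hX⟩ := exists_isSolutionFrom_linearRHS hh ha₀ hA hs hinit
  refine ⟨X, hX, hX.nonneg hh ha₀ hA ha₀_nonneg hA_nonneg hs fun r _ =>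
    indicator_nonneg (fun _ _ => zero_le_one) r, fun t ht => ?_⟩
  have hsup : ⨆ r : Iic s, |indicator {s} (1 : ℝ → ℝ) r| ≤ 1 := ciSup_le fun r => hle r
  calc X t ≤ |X t| := le_abs_self _
    _ ≤ M * Real.exp (-γ * (t - s)) * ⨆ r : Iic s, |indicator {s} (1 : ℝ → ℝ) r| :=
      hstable s hs _ X hinit hX t ht
    _ ≤ M * Real.exp (-γ * (t - s)) := mul_le_of_le_one_right (by positivity) hsup

/-- A nonnegative solution bounded by `M` decreases at most at the rate `C * M`. -/
theorem IsSolutionFrom.sub_mul_le {s T C M : ℝ} (hs : 0 ≤ s)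
    (hA_nonneg : ∀ k j t, 0 ≤ t → 0 ≤ A k j t)
    (hbound : ∀ᵐ t, t ∈ Icc 0 T → |a₀ t| + ∑ k, ∑ j, |A k j t| ≤ C)
    {φ X : ℝ → ℝ} (hX : IsSolutionFrom (linearRHS a₀ A h) s φ X) (hX0 : ∀ t, 0 ≤ X t)
    (hXM : ∀ t, s ≤ t → X t ≤ M) {t : ℝ} (hst : s ≤ t) (htT : t ≤ T) :
    X s - C * M * (t - s) ≤ X t := by
  have hd := (ae_restrict_iff' measurableSet_Ici).1 hX.deriv_eq
  have := sub_le_sub_of_ae_hasDerivAt_le (ψ := fun r => C * M * r) (ψ' := fun _ => C * M) hst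
    (hX.absCont t hst).fun_neg (by fun_prop)
    (fun r => by simpa using (hasDerivAt_id r).const_mul (C * M)) (by
      filter_upwards [hd, hbound] with r h1 h2 hr
      have hr0 : 0 ≤ r := hs.trans hr.1.le
      refine ⟨_, (h1 hr.1.le).neg, ?_⟩
      have h3 : 0 ≤ ∑ k, ∑ j, A k j r * X (h j r) :=
        Finset.sum_nonneg fun k _ => Finset.sum_nonneg fun j _ =>
          mul_nonneg (hA_nonneg k j r hr0) (hX0 _)
      have h4 : 0 ≤ ∑ k, ∑ j, |A k j r| :=
        Finset.sum_nonneg fun k _ => Finset.sum_nonneg fun j _ => abs_nonneg _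
      have h5 : a₀ r ≤ C := by linarith [h2 ⟨hr0, hr.2.le.trans htT⟩, le_abs_self (a₀ r)]
      have hC : 0 ≤ C := by linarith [h2 ⟨hr0, hr.2.le.trans htT⟩, abs_nonneg (a₀ r)]
      have h6 : a₀ r * X r ≤ C * M := mul_le_mul h5 (hXM r hr.1.le) (hX0 r) hC
      unfold linearRHS
      linarith)
  linarith

/-- The function that grows with slope `2 B` between the times `s` and `s'` and is constant
elsewhere. -/
noncomputable def ramp (B s s' t : ℝ) : ℝ := 2 * B * (min t s' - min t s)

theorem ramp_eq_zero (B : ℝ) {s s' t : ℝ} (hss : s ≤ s') (ht : t ≤ s) : ramp B s s' t = 0 := by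
  simp [ramp, min_eq_left ht, min_eq_left (ht.trans hss)]

theorem ramp_monotone {B s s' : ℝ} (hB : 0 ≤ B) (hss : s ≤ s') : Monotone (ramp B s s') := by
  intro t r htr
  refine mul_le_mul_of_nonneg_left ?_ (by positivity)
  grind

theorem absolutelyContinuousOnInterval_ramp (B s s' a b : ℝ) :
    AbsolutelyContinuousOnInterval (ramp B s s') a b := by
  have key : ∀ c, AbsolutelyContinuousOnInterval (fun t => min t c) a b := fun c =>
    (LipschitzWith.id.min_const c).lipschitzOnWith.absolutelyContinuousOnInterval
  exact ((key s').fun_sub (key s)).const_mul (2 * B)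

theorem hasDerivAt_min_const {t s : ℝ} (hts : t ≠ s) :
    HasDerivAt (fun r => min r s) (if t < s then 1 else 0) t := by
  rcases lt_or_gt_of_ne hts with ht | ht
  · rw [if_pos ht]
    refine (hasDerivAt_id t).congr_of_eventuallyEq ?_
    filter_upwards [Iio_mem_nhds ht] with r hr using min_eq_left (le_of_lt hr)
  · rw [if_neg ht.not_gt]
    refine (hasDerivAt_const t s).congr_of_eventuallyEq ?_
    filter_upwards [Ioi_mem_nhds ht] with r hr using min_eq_right (le_of_lt hr)

theorem linearRHS_mul_le (hh : DelayAssumptions h) (hA_nonneg : ∀ k j t, 0 ≤ t → 0 ≤ A k j t)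
    {c X : ℝ → ℝ} (hc : Monotone c) (hX : ∀ t, 0 ≤ X t) {t : ℝ} (ht : 0 ≤ t) :
    linearRHS a₀ A h (fun r => c r * X r) t ≤ c t * linearRHS a₀ A h X t := by
  have : ∑ k, ∑ j, A k j t * (c (h j t) * X (h j t)) ≤
      c t * ∑ k, ∑ j, A k j t * X (h j t) := by
    simp only [Finset.mul_sum]
    refine Finset.sum_le_sum fun k _ => Finset.sum_le_sum fun j _ => ?_
    rw [mul_left_comm (c t)]
    exact mul_le_mul_of_nonneg_left
      (mul_le_mul_of_nonneg_right (hc (hh.le_self j t ht)) (hX _)) (hA_nonneg k j t ht)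
  unfold linearRHS
  linarith

/-- A fundamental solution from time `s`, multiplied by a ramp on `[s, s']`, is a supersolution
for the source that equals `B` on `(s, s')` and vanishes elsewhere, provided that the fundamental
solution is at least `1 / 2` there. The source is written as a difference of step functions, so
that its sum over a partition telescopes. -/
theorem exists_hasDerivAt_ramp_mul (hh : DelayAssumptions h)
    (hA_nonneg : ∀ k j t, 0 ≤ t → 0 ≤ A k j t) {B s s' t : ℝ} (hB : 0 ≤ B) (hss : s ≤ s')
    {X : ℝ → ℝ} (hX : ∀ t, 0 ≤ X t) (ht : 0 ≤ t) (hts : t ≠ s) (hts' : t ≠ s')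
    (hderiv : s ≤ t → HasDerivAt X (linearRHS a₀ A h X t) t)
    (hhalf : s ≤ t → t ≤ s' → 1 / 2 ≤ X t) :
    ∃ d, HasDerivAt (fun r => ramp B s s' r * X r) d t ∧
      linearRHS a₀ A h (fun r => ramp B s s' r * X r) t +
        B * ((if t < s' then 1 else 0) - (if t < s then 1 else 0)) ≤ d := by
  rcases lt_or_gt_of_ne hts with hlt | hgt
  · refine ⟨0, ?_, ?_⟩
    · refine (hasDerivAt_const t (0 : ℝ)).congr_of_eventuallyEq ?_
      filter_upwards [Iio_mem_nhds hlt] with r hr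
      rw [ramp_eq_zero B hss (le_of_lt hr), zero_mul]
    · have h1 := abs_linearRHS_le (a₀ := a₀) (A := A) hh (y := fun r => ramp B s s' r * X r)
        (K := 0) ht fun r hr => by simp [ramp_eq_zero B hss (hr.trans hlt.le)]
      rw [mul_zero] at h1
      rw [if_pos hlt, if_pos (hlt.trans_le hss)]
      linarith [le_abs_self (linearRHS a₀ A h (fun r => ramp B s s' r * X r) t)]
  · have hramp : HasDerivAt (ramp B s s')
        (2 * B * ((if t < s' then 1 else 0) - (if t < s then 1 else 0))) t :=
      ((hasDerivAt_min_const hts').sub (hasDerivAt_min_const hts)).const_mul (2 * B)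
    refine ⟨_, hramp.mul (hderiv hgt.le), ?_⟩
    have h1 := linearRHS_mul_le (a₀ := a₀) hh hA_nonneg (ramp_monotone hB hss) hX ht
    rw [if_neg hgt.not_gt]
    by_cases ht' : t < s'
    · have h2 := mul_le_mul_of_nonneg_left (hhalf hgt.le ht'.le) hB
      rw [if_pos ht']
      linarith
    · rw [if_neg ht']
      linarith

/-- A subsolution of the exponentially stable linear equation with constant source `B` is bounded
above, uniformly in time. -/
theorem le_of_subsolution_source (hh : DelayAssumptions h) (ha₀ : LocallyEssBounded a₀)
    (hA : ∀ k j, LocallyEssBounded (A k j)) (ha₀_nonneg : ∀ t, 0 ≤ t → 0 ≤ a₀ t)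
    (hA_nonneg : ∀ k j t, 0 ≤ t → 0 ≤ A k j t) {M γ : ℝ} (hM : 0 < M) (hγ : 0 < γ)
    (hstable : ∀ t₀ : ℝ, 0 ≤ t₀ → ∀ φ x : ℝ → ℝ, IsInitialFunction t₀ φ →
      IsSolutionFrom (linearRHS a₀ A h) t₀ φ x →
        ∀ t, t₀ ≤ t → |x t| ≤ M * Real.exp (-γ * (t - t₀)) * ⨆ s : Iic t₀, |φ s|)
    {φ x : ℝ → ℝ} {B K : ℝ} (hB : 0 ≤ B) (hφ : IsInitialFunction 0 φ) (hK : ∀ s ≤ 0, |φ s| ≤ K)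
    (hxac : ∀ T, 0 ≤ T → AbsolutelyContinuousOnInterval x 0 T) (hxφ : ∀ t ≤ 0, x t = φ t)
    (hx : ∀ᵐ t, t ∈ Ici (0 : ℝ) → ∃ d, HasDerivAt x d t ∧ d ≤ linearRHS a₀ A h x t + B)
    {T : ℝ} (hT : 0 ≤ T) :
    x T ≤ M * K + 2 * B * M / γ := by
  have hK0 : 0 ≤ K := (abs_nonneg _).trans (hK 0 le_rfl)
  obtain ⟨C, hC, hbound⟩ := exists_coeff_bound ha₀ hA T
  obtain ⟨u, hu⟩ := exists_isSolutionFrom_linearRHS hh ha₀ hA le_rfl hφ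
  -- A mesh so fine that every fundamental solution stays above `1 / 2` during one step.
  obtain ⟨N, hN⟩ := exists_nat_gt (2 * (C * M * T))
  have hN0 : (0 : ℝ) < N := lt_of_le_of_lt (by positivity) hN
  set δ := T / N with hδ
  have hδ0 : 0 ≤ δ := by positivity
  have hδ_half : C * M * δ ≤ 1 / 2 := by
    rw [hδ, ← mul_div_assoc, div_le_iff₀ hN0]
    linarith
  set s : ℕ → ℝ := fun i => i * δ with hs
  have hs0 : ∀ i, 0 ≤ s i := fun i => by positivity
  have hs_succ : ∀ i, s (i + 1) = s i + δ := fun i => by simp only [hs]; push_cast; ring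
  have hss : ∀ i, s i ≤ s (i + 1) := fun i => by rw [hs_succ]; linarith
  have hsN : s N = T := by simp only [hs, hδ]; field_simp
  have hsT : ∀ i ≤ N, s i ≤ T := fun i hi => hsN ▸ monotone_nat_of_le_succ hss hi
  choose X hX hX0 hXM using fun i => exists_fundamentalSolution hh ha₀ hA ha₀_nonneg hA_nonneg hM
    hstable (hs0 i)
  have hXM' : ∀ i t, s i ≤ t → X i t ≤ M := fun i t ht =>
    (hXM i t ht).trans (mul_le_of_le_one_right hM.le (Real.exp_le_one_iff.2 (by nlinarith)))
  have hXs : ∀ i, X i (s i) = 1 := fun i => by simp [(hX i).initial (s i) le_rfl]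
  have hhalf : ∀ i < N, ∀ t, s i ≤ t → t ≤ s (i + 1) → 1 / 2 ≤ X i t := by
    intro i hi t h1 h2
    have h3 := (hX i).sub_mul_le (hs0 i) hA_nonneg hbound (hX0 i) (hXM' i) h1
      (h2.trans (hsT (i + 1) hi))
    rw [hXs] at h3
    have h4 : C * M * (t - s i) ≤ C * M * δ :=
      mul_le_mul_of_nonneg_left (by linarith [hs_succ i]) (by positivity)
    linarith
  set z : ℕ → ℝ → ℝ := fun i t => ramp B (s i) (s (i + 1)) t * X i t with hz
  have hzac : ∀ i ∈ Finset.range N, AbsolutelyContinuousOnInterval (z i) 0 T := by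
    intro i hi
    have hiT := hsT i (Finset.mem_range.1 hi).le
    refine absolutelyContinuousOnInterval_congr
      ((absolutelyContinuousOnInterval_ramp B (s i) (s (i + 1)) 0 T).fun_mul
        (absolutelyContinuousOnInterval_comp_max ((hX i).absCont T hiT) hT hiT)) fun t _ => ?_
    -- The fundamental solution jumps at `s i`, but the ramp vanishes up to that time.
    rcases le_total t (s i) with ht | ht
    · simp [hz, ramp_eq_zero B (hss i) ht]
    · simp [hz, max_eq_left ht]
  have hcmp : x T - u T - ∑ i ∈ Finset.range N, z i T ≤ 0 := by
    have hu' := (ae_restrict_iff' measurableSet_Ici).1 hu.deriv_eq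
    have hX' : ∀ᵐ t, ∀ i, t ∈ Ici (s i) → HasDerivAt (X i) (linearRHS a₀ A h (X i) t) t :=
      ae_all_iff.2 fun i => (ae_restrict_iff' measurableSet_Ici).1 (hX i).deriv_eq
    have hne : ∀ᵐ t : ℝ, ∀ i, t ≠ s i := ae_all_iff.2 fun i => by simp [ae_iff]
    refine nonpos_of_subsolution (t₀ := 0) (T := T)
      (v := fun t => x t - u t - ∑ i ∈ Finset.range N, z i t) hh ha₀ hA ha₀_nonneg hA_nonneg
      le_rfl (((hxac T hT).fun_sub (hu.absCont T hT)).fun_sub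
        (absolutelyContinuousOnInterval_finset_sum _ hzac)) (fun t ht => ?_) ?_ T le_rfl
    · have : ∀ i, z i t = 0 := fun i => by
        simp [hz, ramp_eq_zero B (hss i) (ht.trans (hs0 i))]
      simp [this, hxφ t ht, hu.initial t ht]
    · filter_upwards [hx, hu', hX', hne] with t h1 h2 h3 h4 ht
      obtain ⟨d, hd, hdle⟩ := h1 ht.1.le
      have hzd : ∀ i, ∃ e, i ∈ Finset.range N → HasDerivAt (z i) e t ∧
          linearRHS a₀ A h (z i) t + B * ((if t < s (i + 1) then 1 else 0) -
            (if t < s i then 1 else 0)) ≤ e := by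
        intro i
        by_cases hi : i ∈ Finset.range N
        · obtain ⟨e, he⟩ := exists_hasDerivAt_ramp_mul hh hA_nonneg hB (hss i) (hX0 i) ht.1.le
            (h4 i) (h4 (i + 1)) (h3 i) (hhalf i (Finset.mem_range.1 hi) t)
          exact ⟨e, fun _ => he⟩
        · exact ⟨0, fun h => absurd h hi⟩
      choose e he using hzd
      refine ⟨_, (hd.sub (h2 ht.1.le)).sub (HasDerivAt.fun_sum fun i hi => (he i hi).1), ?_⟩
      have hsum := Finset.sum_le_sum fun i hi => (he i hi).2
      rw [Finset.sum_add_distrib, ← Finset.mul_sum,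
        Finset.sum_range_sub (fun i => if t < s i then (1 : ℝ) else 0), hsN, if_pos ht.2,
        if_neg (by simpa [hs] using ht.1.le), ← linearRHS_finset_sum] at hsum
      rw [linearRHS_sub, linearRHS_sub]
      linarith
  have huT : u T ≤ M * K := by
    refine (le_abs_self _).trans ((hstable 0 le_rfl φ u hφ hu T hT).trans ?_)
    refine mul_le_mul (mul_le_of_le_one_right hM.le (Real.exp_le_one_iff.2 (by nlinarith)))
      (ciSup_le fun r => hK r r.2) (Real.iSup_nonneg fun r => abs_nonneg _) hM.le
  -- `γ * δ ≤ exp (γ * δ) - 1` turns the bound into a telescoping sum of exponentials.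
  have hzT : ∀ i ∈ Finset.range N, z i T ≤ 2 * B * M / γ * Real.exp (-γ * T) *
      (Real.exp (γ * s (i + 1)) - Real.exp (γ * s i)) := by
    intro i hi
    have hi' := Finset.mem_range.1 hi
    have h1 : ramp B (s i) (s (i + 1)) T = 2 * B * δ := by
      rw [ramp, min_eq_right (hsT _ hi'), min_eq_right (hsT _ hi'.le), hs_succ]
      ring
    have h2 : δ * Real.exp (γ * s i) ≤ (Real.exp (γ * s (i + 1)) - Real.exp (γ * s i)) / γ := by
      rw [le_div_iff₀ hγ, hs_succ, mul_add, Real.exp_add]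
      nlinarith [Real.add_one_le_exp (γ * δ), Real.exp_pos (γ * s i)]
    calc z i T = 2 * B * δ * X i T := by rw [hz, ← h1]
      _ ≤ 2 * B * δ * (M * Real.exp (-γ * (T - s i))) :=
        mul_le_mul_of_nonneg_left (hXM i T (hsT i hi'.le)) (by positivity)
      _ = 2 * B * M * Real.exp (-γ * T) * (δ * Real.exp (γ * s i)) := by
        rw [show -γ * (T - s i) = -γ * T + γ * s i by ring, Real.exp_add]
        ring
      _ ≤ 2 * B * M * Real.exp (-γ * T) *
          ((Real.exp (γ * s (i + 1)) - Real.exp (γ * s i)) / γ) :=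
        mul_le_mul_of_nonneg_left h2 (by positivity)
      _ = _ := by ring
  have hsum : ∑ i ∈ Finset.range N, z i T ≤ 2 * B * M / γ := by
    refine (Finset.sum_le_sum hzT).trans ?_
    rw [← Finset.mul_sum, Finset.sum_range_sub (fun i => Real.exp (γ * s i)), hsN, mul_assoc]
    refine mul_le_of_le_one_right (by positivity) ?_
    rw [mul_sub, ← Real.exp_add, neg_mul, neg_add_cancel, Real.exp_zero]
    have : 0 ≤ Real.exp (-(γ * T)) * Real.exp (γ * s 0) := by positivity
    linarith
  linarith

end Source

end DelayEq

/-! ### Boundedness of positive solutions -/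

theorem mainTheorem6 {m l : ℕ}
    (f : Fin m → ℝ → (Fin l → ℝ) → ℝ) (g : ℝ → ℝ → ℝ) (h : Fin l → ℝ → ℝ) (φ : ℝ → ℝ)
    (hfg : DelayEq.NonlinearityAssumptions f g)
    (hh : DelayEq.DelayAssumptions h)
    (hφ : DelayEq.IsInitialFunction 0 φ) (hφ_nonneg : ∀ s ≤ 0, 0 ≤ φ s) (hφ_zero : 0 < φ 0)
    (a₀ : ℝ → ℝ) (A : Fin m → Fin l → ℝ → ℝ) (B : Fin m → ℝ)
    (ha₀ : DelayEq.LocallyEssBounded a₀) (ha₀_nonneg : ∀ t, 0 ≤ t → 0 ≤ a₀ t)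
    (hA : ∀ k j, DelayEq.LocallyEssBounded (A k j))
    (hA_nonneg : ∀ k j t, 0 ≤ t → 0 ≤ A k j t)
    (hB : ∀ k, 0 ≤ B k)
    (hg_lower : ∀ t, 0 ≤ t → ∀ u, 0 ≤ u → a₀ t * u ≤ g t u)
    (hf_upper : ∀ k t, 0 ≤ t → ∀ u : Fin l → ℝ, (∀ j, 0 ≤ u j) →
      f k t u ≤ (∑ j, A k j t * u j) + B k)
    (hstable : DelayEq.IsExponentiallyStable (DelayEq.linearRHS a₀ A h))
    (x : ℝ → ℝ)
    (hx : DelayEq.IsSolutionFrom (DelayEq.nonlinearRHS f g h) 0 φ x)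
    (hx_pos : ∀ t, 0 ≤ t → 0 < x t) :
    ∃ C : ℝ, ∀ t : ℝ, |x t| ≤ C := by
  obtain ⟨M, γ, hM, hγ, hst⟩ := hstable
  obtain ⟨K, hK⟩ := hφ.2
  have hx0 : ∀ t, 0 ≤ x t := by
    intro t
    rcases le_total t 0 with ht | ht
    · rw [hx.initial t ht]
      exact hφ_nonneg t ht
    · exact (hx_pos t ht).le
  have hsub : ∀ᵐ t, t ∈ Ici (0 : ℝ) →
      ∃ d, HasDerivAt x d t ∧ d ≤ DelayEq.linearRHS a₀ A h x t + ∑ k, B k := by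
    filter_upwards [(ae_restrict_iff' measurableSet_Ici).1 hx.deriv_eq] with t ht hmem
    refine ⟨_, ht hmem, ?_⟩
    have h1 := Finset.sum_le_sum fun k (_ : k ∈ Finset.univ) =>
      hf_upper k t hmem (fun j => x (h j t)) fun j => hx0 _
    rw [Finset.sum_add_distrib] at h1
    have h2 := hg_lower t hmem (x t) (hx0 t)
    unfold DelayEq.nonlinearRHS DelayEq.linearRHS
    linarith
  refine ⟨max K (M * K + 2 * (∑ k, B k) * M / γ), fun t => ?_⟩
  rcases le_total t 0 with ht | ht
  · rw [hx.initial t ht]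
    exact le_max_of_le_left (hK t ht)
  · rw [abs_of_nonneg (hx0 t)]
    exact le_max_of_le_right (DelayEq.le_of_subsolution_source hh ha₀ hA ha₀_nonneg hA_nonneg hM hγ
      hst (Finset.sum_nonneg fun k _ => hB k) hφ hK hx.absCont hx.initial hsub ht)
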